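/- Let $0\le\theta_L<\theta_H<\infty$. Let $F$ be an atomless probability distribution with support $[\theta_L,\theta_H]$ (for instance one with a positive density; $[\theta_L,\theta_H]=[0,1]$ is a normalization), with mean $\mu=\mathbb{E}_F[\theta]$. Let $J\ge 1$ be the number of sellers, and let $F^J$ be the distribution of the highest of $J$ independent draws from $F$. Fix the platform size $\lambda\in(0,1]$ and an off-platform quality $\hat q>0$; if $J=1$, assume also $2\hat q\le\theta_H-\theta_L$. Off-platform consumers have no private information, so the off-platform product is sold at price $\mu\hat q$ and the production cost of quality $q$ is $q^2/2$. A consumer on the platform with posterior mean $\theta$ obtains the rent $\max\{0,(\theta-\mu)\hat q\}$. The platform chooses a distribution $\hat F$ of posterior means on $[\theta_L,\theta_H]$ to solve $$\max_{\hat F}\;(1-\lambda)\Big(\mu\hat q-\frac{\hat q^2}{2}\Big)+\lambda\int_{\theta_L}^{\theta_H}\Big(\frac{\theta^2}{2}-\max\{0,(\theta-\mu)\hat q\}\Big)\,d\hat F(\theta)$$ subject to $F^J$ being a mean-preserving spread of $\hat F$, that is, $\int_v^{\theta_H}F^J(t)\,dt\le\int_v^{\theta_H}\hat F(t)\,dt$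 for all $v\in[\theta_L,\theta_H]$, with equality at $v=\theta_L$. Then there exist two real thresholds $x_1\le\mu\le x_2$ such that: 1. The problem has exactly one solution $\hat F^*$. Its distribution function coincides with $F^J$ on $(-\infty,x_1]$ and on $[x_2,\infty)$ (in particular on $[\theta_L,x_1]$, which is empty if $x_1<\theta_L$, and on $[x_2,\theta_H]$), and it has an atom at $\mu$, of mass $F^J(x_2)-F^J(x_1)>0$. 2. The pair $(x_1,x_2)$ is the unique solution in $\mathbb{R}^2$ of $$x_1+2\hat q=x_2,\qquad \mathbb{E}_{F^J}[\theta\mid x_1\le\theta\le x_2]=\mu.$$ -/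

import Mathlib

open MeasureTheory ProbabilityTheory Set

namespace ManagedCampaign

/-- The distribution function `F ^ J` (`J` independent draws from `P`, keep the highest), where
`F` is the distribution function of `P`. -/
noncomputable def powStieltjes (P : Measure ℝ) (J : ℕ) : StieltjesFunction ℝ where
  toFun x := cdf P x ^ J
  mono' _ _ h := pow_le_pow_left₀ (cdf_nonneg P _) (monotone_cdf P h) J
  right_continuous' x := ((cdf P).right_continuous x).pow J

/-- The probability law on `ℝ` whose distribution function is `F ^ J`. -/
noncomputable def highestValueLaw (P : Measure ℝ) (J : ℕ) : Measure ℝ :=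
  (powStieltjes P J).measure

/-- For distributions on `[θL, θH]` with distribution functions `F` and `G`:
`F` is a mean-preserving spread of `G`. -/
def IsMeanPreservingSpread (θL θH : ℝ) (F G : ℝ → ℝ) : Prop :=
  (∀ v ∈ Icc θL θH, ∫ t in v..θH, F t ≤ ∫ t in v..θH, G t) ∧
    ∫ t in θL..θH, F t = ∫ t in θL..θH, G t

/-- The prior mean of a consumer's value for any one seller; consumers without private
information all hold this expectation off the platform. -/
noncomputable def priorMean (P : Measure ℝ) : ℝ := ∫ θ, θ ∂P

/-- The off-platform price of the single product of quality `qhat`: it extracts the whole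
expected willingness to pay of a consumer with expectation `μ`. -/
def offPrice (μ qhat : ℝ) : ℝ := μ * qhat

/-- The rent of an on-platform consumer with posterior mean `θ`: the better of not buying and
buying the off-platform product. -/
noncomputable def rent (μ qhat θ : ℝ) : ℝ := max 0 (θ * qhat - offPrice μ qhat)

/-- The sponsored seller's on-platform profit from a consumer with posterior mean `θ`: the
efficient surplus (production cost `q ^ 2 / 2`) net of the rent. -/
noncomputable def onProfit (μ qhat θ : ℝ) : ℝ := θ ^ 2 / 2 - rent μ qhat θ

/-- The platform's objective, for platform size `lam`, off-platform quality `qhat` and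
distribution `Q` of posterior means for the sponsored product. -/
noncomputable def objective (θL θH μ lam qhat : ℝ) (Q : Measure ℝ) : ℝ :=
  (1 - lam) * (offPrice μ qhat - qhat ^ 2 / 2)
    + lam * ∫ θ in Icc θL θH, onProfit μ qhat θ ∂Q

/-- `Q` is an admissible distribution of posterior means: a probability law on `[θL, θH]` of
which `F ^ J` is a mean-preserving spread. -/
def Feasible (θL θH : ℝ) (J : ℕ) (P Q : Measure ℝ) : Prop :=
  IsProbabilityMeasure Q ∧ (∀ᵐ θ ∂Q, θ ∈ Icc θL θH) ∧
    IsMeanPreservingSpread θL θH (powStieltjes P J) (cdf Q)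

/-- `Q` solves the platform's information design problem with `qhat` held fixed. -/
def IsOptimalDesign (θL θH : ℝ) (J : ℕ) (P : Measure ℝ) (lam qhat : ℝ) (Q : Measure ℝ) : Prop :=
  Feasible θL θH J P Q ∧ ∀ R : Measure ℝ, Feasible θL θH J P R →
    objective θL θH (priorMean P) lam qhat R ≤ objective θL θH (priorMean P) lam qhat Q

/-- The two equations for the thresholds:
`x₁ + 2 * qhat = x₂` and `E[θ | x₁ ≤ θ ≤ x₂] = μ`, the expectation being under `F ^ J`. -/
def ThresholdEquations (J : ℕ) (P : Measure ℝ) (qhat x₁ x₂ : ℝ) : Prop :=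
  x₁ + 2 * qhat = x₂ ∧ ∫ θ, θ ∂(cond (highestValueLaw P J) (Icc x₁ x₂)) = priorMean P

end ManagedCampaign

/-! The proof is linear-programming duality with an explicit certificate. By
`isMeanPreservingSpread_iff`, feasibility of `Q` says that its call curve lies below that of `G = F
^ J` and that the means agree, so `Q` integrates convex functions to at most what `G` does.

The profit is `θ² / 2` below `μ` and `θ² / 2 - (θ - μ) * qhat` above, convex except for a concave
kink at `μ`. A chord bridging the kink must meet the graph at `x₁`, `μ` and `x₂`; these points are
collinear exactly when `x₂ = x₁ + 2 * qhat`. Using the chord on `[x₁, x₂]` and the profit outside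
gives a convex majorant `p` (`shadowPrice`). For feasible `R`, `∫ profit dR ≤ ∫ p dR ≤ ∫ p dG`. The
mean equation makes pooling `[x₁, x₂]` at `μ` feasible, and pooling attains the bound because `p` is
affine there.

Uniqueness of the optimum: equality in the first step confines `R` to the contact set of `p` and the
profit; equality in the second makes the call curves touch outside `(x₁, x₂)`, so the distribution
functions agree there (`cdf_eq_of_call_touch`). Together these determine `R`. The thresholds come
from the intermediate value theorem, and are unique by comparing two shifted windows. -/

namespace ManagedCampaign

/-! ### Call curves and mean-preserving spreads. -/

open Filter Topology

/-- The expected payoff of a call option with strike `t` under `ν`. -/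
noncomputable def call (ν : Measure ℝ) (t : ℝ) : ℝ := ∫ θ, max (θ - t) 0 ∂ν

theorem integrable_of_continuous {ν : Measure ℝ} [IsFiniteMeasure ν] {L H : ℝ}
    (hν : ∀ᵐ θ ∂ν, θ ∈ Icc L H) {φ : ℝ → ℝ} (hφ : Continuous φ) : Integrable φ ν := by
  obtain ⟨C, hC⟩ := isCompact_Icc.exists_bound_of_continuousOn (hφ.continuousOn (s := Icc L H))
  exact .of_bound hφ.aestronglyMeasurable C (hν.mono hC)

theorem integrable_prod_of_ae_mem_Icc {ν : Measure ℝ} [IsFiniteMeasure ν] {L H : ℝ}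
    (hν : ∀ᵐ θ ∂ν, θ ∈ Icc L H) {f : ℝ × ℝ → ℝ} (hf : Continuous f) (a b : ℝ) :
    Integrable f ((volume.restrict (uIoc a b)).prod ν) := by
  rw [← Measure.restrict_eq_self_of_ae_mem hν, Measure.prod_restrict]
  exact (hf.continuousOn.integrableOn_compact (isCompact_uIcc.prod isCompact_Icc)).mono_set
    (prod_mono uIoc_subset_uIcc subset_rfl)

theorem intervalIntegral_indicator_Ici {v H θ : ℝ} (hv : v ≤ H) (hθ : θ ≤ H) :
    ∫ t in v..H, (Ici θ).indicator (fun _ ↦ (1 : ℝ)) t = H - v - max (θ - v) 0 := by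
  rw [intervalIntegral.integral_of_le hv, setIntegral_indicator measurableSet_Ici]
  rcases le_or_gt θ v with h | h
  · rw [inter_eq_left.2 (show Ioc v H ⊆ Ici θ from fun t ht ↦ h.trans ht.1.le),
      max_eq_right (by linarith)]
    simp [hv]
  · have : Ioc v H ∩ Ici θ = Icc θ H := by
      ext t; simp only [mem_inter_iff, mem_Ioc, mem_Ici, mem_Icc]
      exact ⟨fun h' ↦ ⟨h'.2, h'.1.2⟩, fun h' ↦ ⟨⟨h.trans_le h'.1, h'.2⟩, h'.1⟩⟩
    rw [this, max_eq_left (by linarith)]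
    simp [hθ]

/-- Fubini, after writing `cdf ν t` as the integral of the indicator of `θ ≤ t`. -/
theorem integral_cdf_eq {ν : Measure ℝ} [IsProbabilityMeasure ν] {L H : ℝ}
    (hν : ∀ᵐ θ ∂ν, θ ∈ Icc L H) {v : ℝ} (hv : v ≤ H) :
    ∫ t in v..H, cdf ν t = H - v - call ν v := by
  have h1 (t : ℝ) : cdf ν t = ∫ θ, (Ici θ).indicator (fun _ ↦ (1 : ℝ)) t ∂ν := by
    have : (fun θ : ℝ ↦ (Ici θ).indicator (fun _ ↦ (1 : ℝ)) t) = (Iic t).indicator 1 := by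
      ext θ; simp [indicator_apply]
    rw [this, integral_indicator_one measurableSet_Iic, cdf_eq_real]
  have hm : Measurable fun p : ℝ × ℝ ↦ (Ici p.2).indicator (fun _ ↦ (1 : ℝ)) p.1 := by
    have : (fun p : ℝ × ℝ ↦ (Ici p.2).indicator (fun _ ↦ (1 : ℝ)) p.1) =
        {p : ℝ × ℝ | p.2 ≤ p.1}.indicator 1 := by
      ext p; simp [indicator_apply]
    rw [this]
    exact measurable_one.indicator (measurableSet_le measurable_snd measurable_fst)
  have : IsFiniteMeasure (volume.restrict (uIoc v H)) :=
    ⟨by rw [Measure.restrict_apply_univ, uIoc]; exact measure_Ioc_lt_top⟩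
  simp_rw [h1]
  rw [intervalIntegral_integral_swap]
  · rw [integral_congr_ae (hν.mono fun θ hθ ↦ intervalIntegral_indicator_Ici hv hθ.2),
      integral_sub (integrable_const _) (integrable_of_continuous hν (by fun_prop)), call]
    simp
  · refine .of_bound hm.aestronglyMeasurable 1 (.of_forall fun p ↦ ?_)
    simp only [Function.uncurry, indicator_apply]
    split_ifs <;> simp

theorem integral_max_sub_zero (θ : ℝ) (a b : ℝ) :
    ∫ t in a..b, max (θ - t) 0 = max (θ - a) 0 ^ 2 / 2 - max (θ - b) 0 ^ 2 / 2 := by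
  have h := MeasureTheory.integral_eq_of_hasDerivAt_off_countable
    (fun t ↦ -(max (θ - t) 0 ^ 2 / 2)) (fun t ↦ max (θ - t) 0) (a := a) (b := b)
    (countable_singleton θ) (by fun_prop) (fun t ht ↦ ?_)
    (Continuous.intervalIntegrable (by fun_prop) _ _)
  · rw [h]; ring
  · rcases lt_or_gt_of_ne (show t ≠ θ from ht.2) with h | h
    · rw [max_eq_left (by linarith)]
      have : HasDerivAt (fun t ↦ -((θ - t) ^ 2 / 2)) (θ - t) t := by
        have := ((((hasDerivAt_id t).const_sub θ).pow 2).div_const 2).neg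
        exact this.congr_deriv (by simp; ring)
      refine this.congr_of_eventuallyEq ?_
      filter_upwards [Iio_mem_nhds h] with s hs
      rw [max_eq_left (by linarith [mem_Iio.1 hs])]
    · rw [max_eq_right (by linarith)]
      refine (hasDerivAt_const t (0 : ℝ)).congr_of_eventuallyEq ?_
      filter_upwards [Ioi_mem_nhds h] with s hs
      rw [max_eq_right (by linarith [mem_Ioi.1 hs])]
      simp

theorem integral_call {ν : Measure ℝ} [IsFiniteMeasure ν] {L H : ℝ}
    (hν : ∀ᵐ θ ∂ν, θ ∈ Icc L H) (a b : ℝ) :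
    ∫ t in a..b, call ν t = ∫ θ, (max (θ - a) 0 ^ 2 / 2 - max (θ - b) 0 ^ 2 / 2) ∂ν := by
  unfold call
  rw [intervalIntegral_integral_swap]
  · simp_rw [integral_max_sub_zero]
  · exact integrable_prod_of_ae_mem_Icc hν (by fun_prop) a b

section Slopes

variable {ν : Measure ℝ} [IsProbabilityMeasure ν] {L H : ℝ}

theorem mul_measureReal_Ici_le_call_sub (hν : ∀ᵐ θ ∂ν, θ ∈ Icc L H) {s t : ℝ} (hst : s ≤ t) :
    (t - s) * ν.real (Ici t) ≤ call ν s - call ν t := by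
  have hi (t : ℝ) : Integrable (fun θ ↦ max (θ - t) 0) ν :=
    integrable_of_continuous hν (by fun_prop)
  rw [call, call, ← integral_sub (hi s) (hi t), ← integral_indicator_one measurableSet_Ici,
    ← integral_const_mul]
  refine integral_mono
    (((integrable_const (1 : ℝ)).indicator measurableSet_Ici).const_mul _)
    ((hi s).sub (hi t)) fun θ ↦ ?_
  by_cases h : t ≤ θ
  · have : max (θ - s) 0 = θ - s := max_eq_left (by linarith)
    simp [h, this]
  · simp only [indicator_apply, mem_Ici, h, if_false, mul_zero, sub_nonneg]
    exact max_le_max_right _ (by linarith)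

theorem call_sub_le_mul_measureReal_Ioi (hν : ∀ᵐ θ ∂ν, θ ∈ Icc L H) {s t : ℝ} (hst : s ≤ t) :
    call ν s - call ν t ≤ (t - s) * ν.real (Ioi s) := by
  have hi (t : ℝ) : Integrable (fun θ ↦ max (θ - t) 0) ν :=
    integrable_of_continuous hν (by fun_prop)
  rw [call, call, ← integral_sub (hi s) (hi t), ← integral_indicator_one measurableSet_Ioi,
    ← integral_const_mul]
  refine integral_mono ((hi s).sub (hi t))
    (((integrable_const (1 : ℝ)).indicator measurableSet_Ioi).const_mul _) fun θ ↦ ?_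
  by_cases h : s < θ
  · have : max (θ - s) 0 = θ - s := max_eq_left (by linarith)
    simp only [indicator_apply, mem_Ioi, h, if_true, this, Pi.one_apply]
    linarith [le_max_left (θ - t) 0]
  · have h1 : max (θ - s) 0 = 0 := max_eq_right (by linarith)
    have h2 : max (θ - t) 0 = 0 := max_eq_right (by linarith)
    simp [h, h1, h2]

theorem measureReal_Ioi_eq (t : ℝ) : ν.real (Ioi t) = 1 - cdf ν t := by
  rw [cdf_eq_real, ← compl_Iic, probReal_compl_eq_one_sub measurableSet_Iic]

theorem continuous_call (hν : ∀ᵐ θ ∂ν, θ ∈ Icc L H) : Continuous (call ν) := by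
  have h (s t : ℝ) (hst : s ≤ t) : |call ν s - call ν t| ≤ |s - t| := by
    have h1 := mul_measureReal_Ici_le_call_sub hν hst
    have h2 := call_sub_le_mul_measureReal_Ioi hν hst
    have h3 : 0 ≤ (t - s) * ν.real (Ici t) := mul_nonneg (by linarith) measureReal_nonneg
    have h4 : (t - s) * ν.real (Ioi s) ≤ (t - s) * 1 :=
      mul_le_mul_of_nonneg_left measureReal_le_one (by linarith)
    rw [abs_of_nonneg (by linarith), abs_of_nonpos (by linarith)]
    linarith
  refine (LipschitzWith.of_dist_le_mul (K := 1) fun s t ↦ ?_).continuous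
  rw [NNReal.coe_one, one_mul, Real.dist_eq, Real.dist_eq]
  rcases le_total s t with hst | hst
  · exact h s t hst
  · rw [abs_sub_comm, abs_sub_comm s]; exact h t s hst

end Slopes

/-- Two call price curves, one below the other, have the same slope where they touch. -/
theorem cdf_eq_of_call_touch {ρ ν : Measure ℝ} [IsProbabilityMeasure ρ] [IsProbabilityMeasure ν]
    {L H : ℝ} (hρ : ∀ᵐ θ ∂ρ, θ ∈ Icc L H) (hν : ∀ᵐ θ ∂ν, θ ∈ Icc L H)
    (hle : ∀ t, call ρ t ≤ call ν t) {v : ℝ} (hv : call ρ v = call ν v)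
    (hc : ContinuousAt (cdf ν) v) :
    cdf ρ v = cdf ν v ∧ ρ.real (Ici v) = ρ.real (Ioi v) := by
  -- The lower curve touches from below, so just left of `v` it falls no faster than the upper one;
  -- its left slope is `-ρ (Ici v)`.
  have h1 : ρ.real (Ici v) ≤ 1 - cdf ν v := by
    refine ge_of_tendsto (x := 𝓝[<] v) ((continuousAt_const.sub hc).mono_left nhdsWithin_le_nhds) ?_
    filter_upwards [self_mem_nhdsWithin] with s hs
    have hs : s < v := hs
    have e1 := mul_measureReal_Ici_le_call_sub hρ hs.le
    have e2 := call_sub_le_mul_measureReal_Ioi hν hs.le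
    rw [measureReal_Ioi_eq] at e2
    refine le_of_mul_le_mul_left ?_ (sub_pos.2 hs)
    rw [Pi.sub_apply]
    linarith [hle s]
  -- To the right of `v` it falls at least as fast. The two bounds also exclude an atom of `ρ` at
  -- `v`.
  have h2 : 1 - cdf ν v ≤ ρ.real (Ioi v) := by
    refine le_of_tendsto (x := 𝓝[>] v) ((continuousAt_const.sub hc).mono_left nhdsWithin_le_nhds) ?_
    filter_upwards [self_mem_nhdsWithin] with t ht
    have ht : v < t := ht
    have e1 := mul_measureReal_Ici_le_call_sub hν ht.le
    have e2 := call_sub_le_mul_measureReal_Ioi hρ ht.le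
    have e3 : ν.real (Ioi t) ≤ ν.real (Ici t) := measureReal_mono Ioi_subset_Ici_self
    rw [measureReal_Ioi_eq] at e3
    have e4 := mul_le_mul_of_nonneg_left e3 (sub_pos.2 ht).le
    refine le_of_mul_le_mul_left ?_ (sub_pos.2 ht)
    rw [Pi.sub_apply]
    linarith [hle t]
  have h3 : ρ.real (Ioi v) ≤ ρ.real (Ici v) := measureReal_mono Ioi_subset_Ici_self
  have h4 := measureReal_Ioi_eq (ν := ρ) v
  constructor <;> linarith

theorem call_eq_zero {ν : Measure ℝ} {L H : ℝ} (hν : ∀ᵐ θ ∂ν, θ ∈ Icc L H) {t : ℝ} (ht : H ≤ t) :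
    call ν t = 0 := by
  rw [call, integral_congr_ae (g := fun _ ↦ 0) (hν.mono fun θ hθ ↦ ?_)]
  · simp
  · exact max_eq_right (by linarith [hθ.2])

theorem call_eq_mean_sub {ν : Measure ℝ} [IsProbabilityMeasure ν] {L H : ℝ}
    (hν : ∀ᵐ θ ∂ν, θ ∈ Icc L H) {t : ℝ} (ht : t ≤ L) : call ν t = ∫ θ, θ ∂ν - t := by
  rw [call, integral_congr_ae (g := fun θ ↦ θ - t) (hν.mono fun θ hθ ↦ ?_)]
  · rw [integral_sub (integrable_of_continuous hν (by fun_prop)) (integrable_const _)]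
    simp
  · exact max_eq_left (by linarith [hθ.1])

/-- Integrated distribution functions are `H - v - call`, which reverses the inequality. Strikes
outside `[L, H]` add nothing: there a call is worth zero or the mean minus the strike. -/
theorem isMeanPreservingSpread_iff {ρ ν : Measure ℝ} [IsProbabilityMeasure ρ]
    [IsProbabilityMeasure ν] {L H : ℝ} (hLH : L ≤ H) (hρ : ∀ᵐ θ ∂ρ, θ ∈ Icc L H)
    (hν : ∀ᵐ θ ∂ν, θ ∈ Icc L H) :
    IsMeanPreservingSpread L H (cdf ν) (cdf ρ) ↔
      (∀ t, call ρ t ≤ call ν t) ∧ ∫ θ, θ ∂ρ = ∫ θ, θ ∂ν := by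
  unfold IsMeanPreservingSpread
  rw [integral_cdf_eq hρ hLH, integral_cdf_eq hν hLH, call_eq_mean_sub hρ le_rfl,
    call_eq_mean_sub hν le_rfl]
  refine ⟨fun ⟨h1, h2⟩ ↦ ?_, fun ⟨h1, h2⟩ ↦ ⟨fun v hv ↦ ?_, by rw [h2]⟩⟩
  · have h2 : ∫ θ, θ ∂ρ = ∫ θ, θ ∂ν := by linarith
    refine ⟨fun t ↦ ?_, h2⟩
    rcases le_total t L with ht | ht
    · rw [call_eq_mean_sub hρ ht, call_eq_mean_sub hν ht, h2]
    rcases le_total H t with ht' | ht'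
    · rw [call_eq_zero hρ ht', call_eq_zero hν ht']
    have := h1 t ⟨ht, ht'⟩
    rw [integral_cdf_eq hρ ht', integral_cdf_eq hν ht'] at this
    linarith
  · rw [integral_cdf_eq hρ hv.2, integral_cdf_eq hν hv.2]
    linarith [h1 v]

/-- The interval `[x₁, x₂]` has length `2 * q` and conditional mean `m` under the atomless law `ν`
on `[L, H]`. -/
structure IsPoolingInterval (ν : Measure ℝ) (L H m q x₁ x₂ : ℝ) : Prop where
  ae_mem : ∀ᵐ θ ∂ν, θ ∈ Icc L H
  continuous_cdf : Continuous (cdf ν)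
  mem_Icc : m ∈ Icc L H
  left_lt : x₁ < m
  lt_right : m < x₂
  width : x₁ + 2 * q = x₂
  integral_sub_eq_zero : ∫ θ in Icc x₁ x₂, (θ - m) ∂ν = 0

/-- The convex function supporting `onProfit m q` outside `(x₁, x₂)` and at `m`, written on `[a, b]`
as a mixture of calls. -/
noncomputable def shadowPrice (a b m x₁ x₂ θ : ℝ) : ℝ :=
  -(a ^ 2 / 2) + a * θ + (max (θ - a) 0 ^ 2 / 2 - max (θ - x₁) 0 ^ 2 / 2)
    + (m - x₁) / 2 * max (θ - x₁) 0 + (x₂ - m) / 2 * max (θ - x₂) 0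
    + (max (θ - x₂) 0 ^ 2 / 2 - max (θ - b) 0 ^ 2 / 2)

theorem continuous_shadowPrice (a b m x₁ x₂ : ℝ) : Continuous (shadowPrice a b m x₁ x₂) := by
  unfold shadowPrice; fun_prop

theorem continuous_onProfit (m q : ℝ) : Continuous (onProfit m q) := by
  unfold onProfit rent; fun_prop

theorem onProfit_of_le {m q θ : ℝ} (hq : 0 ≤ q) (h : θ ≤ m) : onProfit m q θ = θ ^ 2 / 2 := by
  rw [onProfit, rent, offPrice, max_eq_left, sub_zero]
  nlinarith

theorem onProfit_of_ge {m q θ : ℝ} (hq : 0 ≤ q) (h : m ≤ θ) :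
    onProfit m q θ = θ ^ 2 / 2 - (θ - m) * q := by
  rw [onProfit, rent, offPrice, max_eq_right, sub_mul]
  nlinarith

/-! ### The convex majorant of the profit. -/

section ShadowPrice

variable {a b m q x₁ x₂ θ : ℝ}

theorem shadowPrice_of_le (hx : x₁ ≤ x₂) (hb : x₂ ≤ b) (ha : a ≤ θ) (h : θ ≤ x₁) :
    shadowPrice a b m x₁ x₂ θ = θ ^ 2 / 2 := by
  rw [shadowPrice, max_eq_left (a := θ - a) (by linarith), max_eq_right (a := θ - x₁) (by linarith),
    max_eq_right (a := θ - x₂) (by linarith), max_eq_right (a := θ - b) (by linarith)]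
  ring

theorem shadowPrice_of_mem (ha : a ≤ x₁) (hb : x₂ ≤ b) (h : θ ∈ Icc x₁ x₂) :
    shadowPrice a b m x₁ x₂ θ = x₁ ^ 2 / 2 + (m + x₁) / 2 * (θ - x₁) := by
  obtain ⟨h1, h2⟩ := h
  rw [shadowPrice, max_eq_left (a := θ - a) (by linarith), max_eq_left (a := θ - x₁) (by linarith),
    max_eq_right (a := θ - x₂) (by linarith), max_eq_right (a := θ - b) (by linarith)]
  ring

theorem shadowPrice_of_ge (ha : a ≤ x₁) (hx : x₁ + 2 * q = x₂) (hx' : x₁ ≤ x₂) (hb : θ ≤ b)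
    (h : x₂ ≤ θ) : shadowPrice a b m x₁ x₂ θ = θ ^ 2 / 2 - (θ - m) * q := by
  rw [shadowPrice, max_eq_left (a := θ - a) (by linarith), max_eq_left (a := θ - x₁) (by linarith),
    max_eq_left (a := θ - x₂) (by linarith), max_eq_right (a := θ - b) (by linarith)]
  subst hx
  ring

theorem onProfit_le_shadowPrice (ha : a ≤ x₁) (hb : x₂ ≤ b) (h1 : x₁ < m) (h2 : m < x₂)
    (hx : x₁ + 2 * q = x₂) (hθ : θ ∈ Icc a b) :
    onProfit m q θ ≤ shadowPrice a b m x₁ x₂ θ ∧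
      (onProfit m q θ = shadowPrice a b m x₁ x₂ θ ↔ θ ≤ x₁ ∨ θ = m ∨ x₂ ≤ θ) := by
  have hq : 0 ≤ q := by linarith
  rcases le_or_gt θ x₁ with h | h
  · rw [onProfit_of_le hq (by linarith), shadowPrice_of_le (by linarith) hb hθ.1 h]
    simp [h]
  rcases le_or_gt x₂ θ with h' | h'
  · rw [onProfit_of_ge hq (by linarith), shadowPrice_of_ge ha hx (by linarith) hθ.2 h']
    simp [h']
  rw [shadowPrice_of_mem ha hb ⟨h.le, h'.le⟩]
  -- On each side of `m` the gap between chord and profit is a quadratic vanishing at `m` and at the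
  -- nearer threshold; `c` is half the distance to that threshold.
  have key (c : ℝ) (hc : 0 < c) (P S : ℝ) (hPS : S - P = c * |θ - m|) :
      P ≤ S ∧ (P = S ↔ θ ≤ x₁ ∨ θ = m ∨ x₂ ≤ θ) := by
    have h0 : 0 ≤ c * |θ - m| := by positivity
    refine ⟨by linarith, fun e ↦ .inr (.inl ?_), ?_⟩
    · have : c * |θ - m| = 0 := by linarith
      simpa [hc.ne', sub_eq_zero] using this
    · rintro (e | e | e)
      · linarith
      · rw [e, sub_self, abs_zero, mul_zero] at hPS; linarith
      · linarith
  rcases le_total θ m with hm | hm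
  · rw [onProfit_of_le hq hm]
    refine key ((θ - x₁) / 2) (by linarith) _ _ ?_
    rw [abs_of_nonpos (by linarith)]
    ring
  · rw [onProfit_of_ge hq hm]
    refine key ((x₂ - θ) / 2) (by linarith) _ _ ?_
    rw [abs_of_nonneg (by linarith)]
    subst hx
    ring

theorem integral_shadowPrice {ν : Measure ℝ} [IsProbabilityMeasure ν] {L H : ℝ}
    (hν : ∀ᵐ θ ∂ν, θ ∈ Icc L H) (a b m x₁ x₂ : ℝ) :
    ∫ θ, shadowPrice a b m x₁ x₂ θ ∂ν = -(a ^ 2 / 2) + a * ∫ θ, θ ∂ν + (∫ t in a..x₁, call ν t)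
      + (m - x₁) / 2 * call ν x₁ + (x₂ - m) / 2 * call ν x₂ + ∫ t in x₂..b, call ν t := by
  have hi {φ : ℝ → ℝ} (hφ : Continuous φ) : Integrable φ ν := integrable_of_continuous hν hφ
  unfold shadowPrice
  rw [integral_call hν, integral_call hν, call, call,
    integral_add (hi (by fun_prop)) (hi (by fun_prop)),
    integral_add (hi (by fun_prop)) (hi (by fun_prop)),
    integral_add (hi (by fun_prop)) (hi (by fun_prop)),
    integral_add (hi (by fun_prop)) (hi (by fun_prop)),
    integral_add (hi (by fun_prop)) (hi (by fun_prop)),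
    integral_const_mul, integral_const_mul, integral_const_mul]
  simp

end ShadowPrice

/-- The law `ν` after pooling `I` into an atom at `m`. -/
noncomputable def pool (ν : Measure ℝ) (I : Set ℝ) (m : ℝ) : Measure ℝ :=
  ν.restrict Iᶜ + ν I • Measure.dirac m

theorem ae_pool {ν : Measure ℝ} {I : Set ℝ} {m : ℝ} {p : ℝ → Prop}
    (hp : ∀ᵐ θ ∂ν, θ ∉ I → p θ) (hI : MeasurableSet I) (hm : p m) :
    ∀ᵐ θ ∂pool ν I m, p θ := by
  rw [pool, ae_add_measure_iff]
  refine ⟨(ae_restrict_iff' hI.compl).2 hp, Measure.ae_smul_measure ?_ _⟩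
  rw [ae_dirac_eq]
  exact hm

/-! ### Pooling an interval at its conditional mean. -/

section Pool

variable {ν : Measure ℝ} [IsProbabilityMeasure ν] {I : Set ℝ} {m : ℝ}

theorem isProbabilityMeasure_pool (hI : MeasurableSet I) : IsProbabilityMeasure (pool ν I m) := by
  constructor
  simp only [pool, Measure.coe_add, Pi.add_apply, Measure.restrict_apply_univ, Measure.coe_smul,
    Pi.smul_apply, measure_univ, smul_eq_mul, mul_one]
  rw [add_comm, prob_add_prob_compl hI]

/-- Since `θ - m` integrates to zero over `I`, the slope `c` is free and can be chosen to suit `φ`: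
a supporting slope at `m` gives Jensen's inequality, and an affine `φ` gives equality. -/
theorem integral_sub_integral_pool {L H : ℝ} (hν : ∀ᵐ θ ∂ν, θ ∈ Icc L H) (hI : MeasurableSet I)
    (h0 : ∫ θ in I, (θ - m) ∂ν = 0) {φ : ℝ → ℝ} (hφ : Continuous φ) (c : ℝ) :
    ∫ θ, φ θ ∂ν - ∫ θ, φ θ ∂pool ν I m = ∫ θ in I, (φ θ - (φ m + c * (θ - m))) ∂ν := by
  have hi {φ : ℝ → ℝ} (hφ : Continuous φ) : Integrable φ ν := integrable_of_continuous hν hφ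
  have hs : Integrable φ (ν I • Measure.dirac m) :=
    (integrable_dirac (by simp)).smul_measure (measure_ne_top _ _)
  rw [pool, integral_add_measure (hi hφ).integrableOn hs, integral_smul_measure, integral_dirac,
    ← integral_add_compl hI (hi hφ), integral_sub (hi hφ).integrableOn
      (hi (by fun_prop)).integrableOn,
    integral_add (integrable_const _) (hi (by fun_prop)).integrableOn, integral_const_mul, h0,
    setIntegral_const]
  simp only [smul_eq_mul, measureReal_def]
  ring

end Pool

/-! ### Optimality of pooling, and the equality case. -/

namespace IsPoolingInterval

variable {ν : Measure ℝ} {L H m q x₁ x₂ : ℝ}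

theorem onProfit_le_shadowPrice (h : IsPoolingInterval ν L H m q x₁ x₂) {θ : ℝ}
    (hθ : θ ∈ Icc L H) :
    onProfit m q θ ≤ shadowPrice (min L x₁) (max H x₂) m x₁ x₂ θ ∧
      (onProfit m q θ = shadowPrice (min L x₁) (max H x₂) m x₁ x₂ θ ↔
        θ ≤ x₁ ∨ θ = m ∨ x₂ ≤ θ) :=
  ManagedCampaign.onProfit_le_shadowPrice (min_le_right _ _) (le_max_right _ _) h.left_lt h.lt_right
    h.width ⟨(min_le_left _ _).trans hθ.1, hθ.2.trans (le_max_left _ _)⟩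

theorem ae_mem_pool (h : IsPoolingInterval ν L H m q x₁ x₂) :
    ∀ᵐ θ ∂pool ν (Icc x₁ x₂) m, θ ∈ Icc L H :=
  ae_pool (h.ae_mem.mono fun _ hθ _ ↦ hθ) measurableSet_Icc h.mem_Icc

variable {ρ : Measure ℝ} [IsProbabilityMeasure ρ]

theorem integral_onProfit_le (h : IsPoolingInterval ν L H m q x₁ x₂) (hρ : ∀ᵐ θ ∂ρ, θ ∈ Icc L H) :
    ∫ θ, onProfit m q θ ∂ρ ≤ ∫ θ, shadowPrice (min L x₁) (max H x₂) m x₁ x₂ θ ∂ρ :=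
  integral_mono_ae (integrable_of_continuous hρ (continuous_onProfit _ _))
    (integrable_of_continuous hρ (continuous_shadowPrice _ _ _ _ _))
    (hρ.mono fun _ hθ ↦ (h.onProfit_le_shadowPrice hθ).1)

theorem ae_of_integral_eq (h : IsPoolingInterval ν L H m q x₁ x₂) (hρ : ∀ᵐ θ ∂ρ, θ ∈ Icc L H)
    (he : ∫ θ, onProfit m q θ ∂ρ = ∫ θ, shadowPrice (min L x₁) (max H x₂) m x₁ x₂ θ ∂ρ) :
    ∀ᵐ θ ∂ρ, θ ≤ x₁ ∨ θ = m ∨ x₂ ≤ θ := by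
  have := (integral_eq_iff_of_ae_le (integrable_of_continuous hρ (continuous_onProfit _ _))
    (integrable_of_continuous hρ (continuous_shadowPrice _ _ _ _ _))
    (hρ.mono fun _ hθ ↦ (h.onProfit_le_shadowPrice hθ).1)).1 he
  filter_upwards [this, hρ] with θ h1 h2
  exact (h.onProfit_le_shadowPrice h2).2.1 h1

variable [IsProbabilityMeasure ν]

theorem integral_pool_id (h : IsPoolingInterval ν L H m q x₁ x₂) :
    ∫ θ, θ ∂pool ν (Icc x₁ x₂) m = ∫ θ, θ ∂ν := by
  have := integral_sub_integral_pool h.ae_mem measurableSet_Icc h.integral_sub_eq_zero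
    continuous_id 1
  simp only [id, one_mul, add_sub_cancel, sub_self, integral_zero] at this
  linarith

/-- Jensen's inequality: the call payoff has a supporting line at `m` of slope 1 for strikes up to
`m` and slope 0 for strikes from `m` on. -/
theorem call_pool_le (h : IsPoolingInterval ν L H m q x₁ x₂) (t : ℝ) :
    call (pool ν (Icc x₁ x₂) m) t ≤ call ν t := by
  rw [← sub_nonneg, call, call]
  rcases le_total t m with ht | ht
  · rw [integral_sub_integral_pool h.ae_mem measurableSet_Icc h.integral_sub_eq_zero
      (φ := fun θ ↦ max (θ - t) 0) (by fun_prop) 1]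
    refine integral_nonneg fun θ ↦ ?_
    simp only [Pi.zero_apply, max_eq_left (show 0 ≤ m - t by linarith)]
    linarith [le_max_left (θ - t) 0]
  · rw [integral_sub_integral_pool h.ae_mem measurableSet_Icc h.integral_sub_eq_zero
      (φ := fun θ ↦ max (θ - t) 0) (by fun_prop) 0]
    refine integral_nonneg fun θ ↦ ?_
    simp only [Pi.zero_apply, max_eq_right (show m - t ≤ 0 by linarith)]
    linarith [le_max_right (θ - t) 0]

/-- The pooled law lives on the contact set, and pooling does not change the integral of a function
affine on `[x₁, x₂]`. -/
theorem integral_onProfit_pool (h : IsPoolingInterval ν L H m q x₁ x₂) :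
    ∫ θ, onProfit m q θ ∂pool ν (Icc x₁ x₂) m =
      ∫ θ, shadowPrice (min L x₁) (max H x₂) m x₁ x₂ θ ∂ν := by
  have h1 : ∀ᵐ θ ∂pool ν (Icc x₁ x₂) m,
      onProfit m q θ = shadowPrice (min L x₁) (max H x₂) m x₁ x₂ θ := by
    refine ae_pool (h.ae_mem.mono fun θ hθ hI ↦ (h.onProfit_le_shadowPrice hθ).2.2 ?_)
      measurableSet_Icc ((h.onProfit_le_shadowPrice h.mem_Icc).2.2 (.inr (.inl rfl)))
    by_contra! hc
    exact hI ⟨hc.1.le, hc.2.2.le⟩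
  have h2 := integral_sub_integral_pool h.ae_mem measurableSet_Icc h.integral_sub_eq_zero
    (continuous_shadowPrice (min L x₁) (max H x₂) m x₁ x₂) ((m + x₁) / 2)
  rw [setIntegral_congr_fun (g := fun _ ↦ 0) measurableSet_Icc fun θ hθ ↦ ?_] at h2
  · rw [integral_congr_ae h1]
    simp only [integral_zero] at h2
    linarith
  · simp only
    rw [shadowPrice_of_mem (min_le_right _ _) (le_max_right _ _) hθ,
      shadowPrice_of_mem (min_le_right _ _) (le_max_right _ _) ⟨h.left_lt.le, h.lt_right.le⟩]
    ring

/-- Up to terms fixed by the mean, `integral_shadowPrice` is a mixture of call values with unit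
density outside `(x₁, x₂)` and positive weights at `x₁` and `x₂`. Equality of the mixtures therefore
forces equality at each such strike, by continuity. -/
theorem integral_shadowPrice_le (h : IsPoolingInterval ν L H m q x₁ x₂)
    (hρ : ∀ᵐ θ ∂ρ, θ ∈ Icc L H) (hle : ∀ t, call ρ t ≤ call ν t) (hm : ∫ θ, θ ∂ρ = ∫ θ, θ ∂ν) :
    ∫ θ, shadowPrice (min L x₁) (max H x₂) m x₁ x₂ θ ∂ρ ≤
      ∫ θ, shadowPrice (min L x₁) (max H x₂) m x₁ x₂ θ ∂ν ∧
    (∫ θ, shadowPrice (min L x₁) (max H x₂) m x₁ x₂ θ ∂ρ =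
      ∫ θ, shadowPrice (min L x₁) (max H x₂) m x₁ x₂ θ ∂ν →
      ∀ v, v ≤ x₁ ∨ x₂ ≤ v → call ρ v = call ν v) := by
  have c1 : Continuous (call ρ) := continuous_call hρ
  have c2 : Continuous (call ν) := continuous_call h.ae_mem
  have i1 {a b : ℝ} (hab : a ≤ b) : ∫ t in a..b, call ρ t ≤ ∫ t in a..b, call ν t :=
    intervalIntegral.integral_mono_on hab (c1.intervalIntegrable _ _) (c2.intervalIntegrable _ _)
      fun t _ ↦ hle t
  have i2 {a b : ℝ} (hab : a < b) (e : ∫ t in a..b, call ρ t = ∫ t in a..b, call ν t)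
      {v : ℝ} (hv : v ∈ Icc a b) : call ρ v = call ν v := by
    by_contra hne
    exact (intervalIntegral.integral_lt_integral_of_continuousOn_of_le_of_exists_lt hab
      c1.continuousOn c2.continuousOn (fun t _ ↦ hle t) ⟨v, hv, (hle v).lt_of_ne hne⟩).ne e
  have j1 := i1 (min_le_right L x₁)
  have j2 := i1 (le_max_right H x₂)
  have p1 : 0 < (m - x₁) / 2 := by linarith [h.left_lt]
  have p2 : 0 < (x₂ - m) / 2 := by linarith [h.lt_right]
  have k1 := mul_le_mul_of_nonneg_left (hle x₁) p1.le
  have k2 := mul_le_mul_of_nonneg_left (hle x₂) p2.le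
  rw [integral_shadowPrice hρ, integral_shadowPrice h.ae_mem, hm]
  refine ⟨by linarith, fun he v hv ↦ ?_⟩
  rcases hv with hv | hv
  · rcases hv.eq_or_lt with rfl | hv'
    · exact mul_left_cancel₀ p1.ne' (by linarith)
    rcases le_total v L with hL | hL
    · rw [call_eq_mean_sub hρ hL, call_eq_mean_sub h.ae_mem hL, hm]
    · exact i2 ((min_le_left _ _).trans_lt (hL.trans_lt hv')) (by linarith)
        ⟨(min_le_left _ _).trans hL, hv⟩
  · rcases hv.eq_or_lt with rfl | hv'
    · exact mul_left_cancel₀ p2.ne' (by linarith)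
    rcases le_total H v with hH | hH
    · rw [call_eq_zero hρ hH, call_eq_zero h.ae_mem hH]
    · exact i2 ((hv'.trans_le hH).trans_le (le_max_left _ _)) (by linarith)
        ⟨hv, hH.trans (le_max_left _ _)⟩

/-- The distribution function of a law that attains the bound of `integral_onProfit_le`. -/
theorem cdf_of_integral_eq (h : IsPoolingInterval ν L H m q x₁ x₂)
    (hρ : ∀ᵐ θ ∂ρ, θ ∈ Icc L H) (hle : ∀ t, call ρ t ≤ call ν t) (hm : ∫ θ, θ ∂ρ = ∫ θ, θ ∂ν)
    (he : ∫ θ, onProfit m q θ ∂ρ = ∫ θ, shadowPrice (min L x₁) (max H x₂) m x₁ x₂ θ ∂ν) :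
    (∀ v, v ≤ x₁ ∨ x₂ ≤ v → cdf ρ v = cdf ν v) ∧ (∀ v, x₁ ≤ v → v < m → cdf ρ v = cdf ν x₁) ∧
      (∀ v, m ≤ v → v ≤ x₂ → cdf ρ v = cdf ν x₂) := by
  have h1 := h.integral_onProfit_le hρ
  obtain ⟨h2, h3⟩ := h.integral_shadowPrice_le hρ hle hm
  have hs := h.ae_of_integral_eq hρ (by linarith)
  have ht (v : ℝ) (hv : v ≤ x₁ ∨ x₂ ≤ v) := cdf_eq_of_call_touch hρ h.ae_mem hle
    (h3 (by linarith) v hv) h.continuous_cdf.continuousAt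
  refine ⟨fun v hv ↦ (ht v hv).1, fun v hv hv' ↦ ?_, fun v hv hv' ↦ ?_⟩
  · rw [← (ht x₁ (.inl le_rfl)).1, cdf_eq_real, cdf_eq_real]
    refine measureReal_congr (hs.mono fun θ hθ ↦ propext ⟨fun hv1 ↦ ?_, fun hv1 ↦ ?_⟩)
    · have hv1 : θ ≤ v := hv1
      have := h.lt_right
      rcases hθ with hθ | hθ | hθ
      · exact hθ
      · linarith
      · linarith
    · exact (show θ ≤ x₁ from hv1).trans hv
  · rcases hv'.eq_or_lt with rfl | hv2
    · exact (ht v (.inr le_rfl)).1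
    -- No mass lies strictly between `m` and `x₂`; the touching lemma excludes an atom at `x₂`, so
    -- `Iio x₂` can be traded for `Iic x₂`.
    have h4 : ρ.real (Iic v) = ρ.real (Iio x₂) := by
      refine measureReal_congr (hs.mono fun θ hθ ↦ propext ⟨fun hv1 ↦ ?_, fun hv1 ↦ ?_⟩)
      · exact (show θ ≤ v from hv1).trans_lt hv2
      · have hv1 : θ < x₂ := hv1
        have := h.left_lt
        change θ ≤ v
        rcases hθ with hθ | hθ | hθ <;> linarith
    rw [cdf_eq_real, h4, ← compl_Ici, probReal_compl_eq_one_sub measurableSet_Ici,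
      (ht x₂ (.inr le_rfl)).2, measureReal_Ioi_eq, (ht x₂ (.inr le_rfl)).1]
    ring

theorem eq_pool_of_integral_eq (h : IsPoolingInterval ν L H m q x₁ x₂)
    (hρ : ∀ᵐ θ ∂ρ, θ ∈ Icc L H) (hle : ∀ t, call ρ t ≤ call ν t) (hm : ∫ θ, θ ∂ρ = ∫ θ, θ ∂ν)
    (he : ∫ θ, onProfit m q θ ∂ρ = ∫ θ, shadowPrice (min L x₁) (max H x₂) m x₁ x₂ θ ∂ν) :
    ρ = pool ν (Icc x₁ x₂) m := by
  have : IsProbabilityMeasure (pool ν (Icc x₁ x₂) m) := isProbabilityMeasure_pool measurableSet_Icc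
  obtain ⟨a1, a2, a3⟩ := h.cdf_of_integral_eq hρ hle hm he
  obtain ⟨b1, b2, b3⟩ := h.cdf_of_integral_eq h.ae_mem_pool h.call_pool_le h.integral_pool_id
    h.integral_onProfit_pool
  refine Measure.eq_of_cdf _ _ (StieltjesFunction.ext fun v ↦ ?_)
  rcases le_total v x₁ with h1 | h1
  · rw [a1 v (.inl h1), b1 v (.inl h1)]
  rcases le_total x₂ v with h2 | h2
  · rw [a1 v (.inr h2), b1 v (.inr h2)]
  rcases lt_or_ge v m with h3 | h3
  · rw [a2 v h1 h3, b2 v h1 h3]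
  · rw [a3 v h3 h2, b3 v h3 h2]

theorem cdf_pool (h : IsPoolingInterval ν L H m q x₁ x₂) {v : ℝ} (hv : v ≤ x₁ ∨ x₂ ≤ v) :
    cdf (pool ν (Icc x₁ x₂) m) v = cdf ν v :=
  have : IsProbabilityMeasure (pool ν (Icc x₁ x₂) m) := isProbabilityMeasure_pool measurableSet_Icc
  (h.cdf_of_integral_eq h.ae_mem_pool h.call_pool_le h.integral_pool_id
    h.integral_onProfit_pool).1 v hv

end IsPoolingInterval

/-! ### Atomless laws and conditional means. -/

section Atomless

variable {ν : Measure ℝ} [IsProbabilityMeasure ν]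

theorem continuous_cdf [NullSingletonClass ν] : Continuous (cdf ν) := by
  refine continuous_iff_continuousAt.2 fun x ↦ ?_
  rw [(monotone_cdf ν).continuousAt_iff_leftLim_eq_rightLim, StieltjesFunction.rightLim_eq]
  have h : (cdf ν).measure {x} = 0 := by rw [measure_cdf, measure_singleton]
  rw [StieltjesFunction.measure_singleton, ENNReal.ofReal_eq_zero] at h
  exact le_antisymm ((monotone_cdf ν).leftLim_le le_rfl) (by linarith)

theorem measureReal_Icc_eq [NullSingletonClass ν] {a b : ℝ} (hab : a ≤ b) :
    ν.real (Icc a b) = cdf ν b - cdf ν a := by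
  rw [measureReal_congr Ioc_ae_eq_Icc.symm, measureReal_def]
  nth_rw 1 [← measure_cdf ν]
  rw [StieltjesFunction.measure_Ioc, ENNReal.toReal_ofReal (sub_nonneg.2 (monotone_cdf ν hab))]

theorem ae_mem_Icc_of_cdf {L H : ℝ} (hL : cdf ν L = 0) (hH : cdf ν H = 1) :
    ∀ᵐ θ ∂ν, θ ∈ Icc L H := by
  have h1 : ν (Iic L) = 0 := by rw [← ofReal_cdf, hL, ENNReal.ofReal_zero]
  have h2 : ν (Ioi H) = 0 := by
    rw [← measureReal_eq_zero_iff, measureReal_Ioi_eq, hH, sub_self]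
  filter_upwards [measure_eq_zero_iff_ae_notMem.1 h1, measure_eq_zero_iff_ae_notMem.1 h2]
    with θ k1 k2
  exact ⟨(not_le.1 k1).le, not_lt.1 k2⟩

/-- Conditioning on a null set gives the zero measure, whose integral is the default value 0; `m ≠
0` rules this case out. -/
theorem integral_cond_eq_iff {L H m : ℝ} (hν : ∀ᵐ θ ∂ν, θ ∈ Icc L H) (hm : m ≠ 0) (I : Set ℝ) :
    ∫ θ, θ ∂(ProbabilityTheory.cond ν I) = m ↔ 0 < ν.real I ∧ ∫ θ in I, (θ - m) ∂ν = 0 := by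
  have hi : Integrable (fun θ ↦ θ) ν := integrable_of_continuous hν continuous_id
  rw [ProbabilityTheory.cond, integral_smul_measure,
    integral_sub hi.integrableOn (integrable_const _),
    setIntegral_const, smul_eq_mul, smul_eq_mul, ENNReal.toReal_inv, ← measureReal_def]
  rcases measureReal_nonneg (μ := ν) (s := I) |>.eq_or_lt with h | h
  · simp [← h, hm.symm]
  · rw [inv_mul_eq_iff_eq_mul₀ h.ne', sub_eq_zero]
    simp [h]

end Atomless

/-! ### Existence and uniqueness of the thresholds. -/

section Thresholds

variable {ν : Measure ℝ} [NullSingletonClass ν] {L H m q : ℝ}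

theorem setIntegral_Icc_eq_intervalIntegral {a b : ℝ} (hab : a ≤ b) (φ : ℝ → ℝ) :
    ∫ θ in Icc a b, φ θ ∂ν = ∫ θ in a..b, φ θ ∂ν := by
  rw [intervalIntegral.integral_of_le hab, integral_Icc_eq_integral_Ioc]

variable [IsProbabilityMeasure ν]

theorem setIntegral_sub_pos (hν : ∀ᵐ θ ∂ν, θ ∈ Icc L H) {a b : ℝ} (ha : m ≤ a)
    (h : 0 < ν.real (Icc a b)) : 0 < ∫ θ in Icc a b, (θ - m) ∂ν := by
  rw [integral_Icc_eq_integral_Ioo, setIntegral_pos_iff_support_of_nonneg_ae,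
    inter_eq_right.2 (show Ioo a b ⊆ Function.support _ from
      fun θ hθ ↦ (sub_pos.2 (ha.trans_lt hθ.1)).ne'),
    measure_congr Ioo_ae_eq_Icc]
  · exact pos_iff_ne_zero.2 fun h' ↦ h.ne' ((measureReal_eq_zero_iff (measure_ne_top _ _)).2 h')
  · exact (ae_restrict_iff' measurableSet_Ioo).2
      (.of_forall fun θ hθ ↦ (sub_pos.2 (ha.trans_lt hθ.1)).le)
  · exact (integrable_of_continuous hν (by fun_prop)).integrableOn

theorem setIntegral_sub_neg (hν : ∀ᵐ θ ∂ν, θ ∈ Icc L H) {a b : ℝ} (hb : b ≤ m)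
    (h : 0 < ν.real (Icc a b)) : ∫ θ in Icc a b, (θ - m) ∂ν < 0 := by
  rw [← neg_pos, ← integral_neg, integral_Icc_eq_integral_Ioo,
    setIntegral_pos_iff_support_of_nonneg_ae,
    inter_eq_right.2 (show Ioo a b ⊆ Function.support _ from
      fun θ hθ ↦ (neg_pos.2 (sub_neg.2 (hθ.2.trans_le hb))).ne'),
    measure_congr Ioo_ae_eq_Icc]
  · exact pos_iff_ne_zero.2 fun h' ↦ h.ne' ((measureReal_eq_zero_iff (measure_ne_top _ _)).2 h')
  · exact (ae_restrict_iff' measurableSet_Ioo).2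
      (.of_forall fun θ hθ ↦ (neg_pos.2 (sub_neg.2 (hθ.2.trans_le hb))).le)
  · exact (integrable_of_continuous hν (by fun_prop)).integrableOn

theorem isPoolingInterval_of_measureReal_pos (hν : ∀ᵐ θ ∂ν, θ ∈ Icc L H) (hm : m ∈ Icc L H) {y : ℝ}
    (h : 0 < ν.real (Icc y (y + 2 * q))) (h0 : ∫ θ in Icc y (y + 2 * q), (θ - m) ∂ν = 0) :
    IsPoolingInterval ν L H m q y (y + 2 * q) where
  ae_mem := hν
  continuous_cdf := continuous_cdf
  mem_Icc := hm
  left_lt := by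
    by_contra! hc
    exact (setIntegral_sub_pos hν hc h).ne' h0
  lt_right := by
    by_contra! hc
    exact (setIntegral_sub_neg hν hc h).ne h0
  width := rfl
  integral_sub_eq_zero := h0

theorem exists_isPoolingInterval (hν : ∀ᵐ θ ∂ν, θ ∈ Icc L H) (hm : m ∈ Ioo L H) (hq : 0 < q)
    (hpos : ∀ a b, a < b → a < H → L < b → 0 < ν.real (Icc a b)) :
    ∃ x, IsPoolingInterval ν L H m q x (x + 2 * q) := by
  have hi (a b : ℝ) : IntervalIntegrable (fun θ ↦ θ - m) ν a b :=
    (integrable_of_continuous hν (by fun_prop)).intervalIntegrable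
  have hc : Continuous fun x ↦ ∫ θ in Icc x (x + 2 * q), (θ - m) ∂ν := by
    have h (x : ℝ) : ∫ θ in Icc x (x + 2 * q), (θ - m) ∂ν =
        (∫ θ in (0 : ℝ)..x + 2 * q, (θ - m) ∂ν) - ∫ θ in (0 : ℝ)..x, (θ - m) ∂ν := by
      rw [setIntegral_Icc_eq_intervalIntegral (by linarith),
        intervalIntegral.integral_interval_sub_left (hi _ _) (hi _ _)]
    simp_rw [h]
    have hp := intervalIntegral.continuous_primitive hi 0
    exact (hp.comp (continuous_add_const _)).sub hp
  -- The window starting at `m - 2 * q` lies below `m`, the one starting at `m` lies above it, so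
  -- the integral changes sign.
  obtain ⟨x, hx, hx0⟩ := intermediate_value_Icc (by linarith : m - 2 * q ≤ m) hc.continuousOn
    (show (0 : ℝ) ∈ Icc _ _ from
      ⟨(setIntegral_sub_neg hν (by linarith)
        (hpos _ _ (by linarith) (by linarith [hm.2]) (by linarith [hm.1]))).le,
      (setIntegral_sub_pos hν le_rfl
        (hpos _ _ (by linarith) hm.2 (by linarith [hm.1]))).le⟩)
  exact ⟨x, isPoolingInterval_of_measureReal_pos hν ⟨hm.1.le, hm.2.le⟩
    (hpos _ _ (by linarith) (by linarith [hx.2, hm.2]) (by linarith [hx.1, hm.1])) hx0⟩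

/-- Sliding the window from `y` to `z` drops values below `m` and adds values above `m`, so the
integral can stay zero only if both pieces are null. Then the first window covers `[L, H]` and is
strictly longer, and the overall mean is `m`, which `hmean` forbids. -/
theorem not_lt_of_isPoolingInterval (hm : m ∈ Ioo L H)
    (hpos : ∀ a b, a < b → a < H → L < b → 0 < ν.real (Icc a b))
    (hmean : ∫ θ, θ ∂ν = m → 2 * q ≤ H - L) {y z : ℝ}
    (hy : IsPoolingInterval ν L H m q y (y + 2 * q))
    (hz : IsPoolingInterval ν L H m q z (z + 2 * q)) : ¬ y < z := by
  intro hyz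
  have hν := hy.ae_mem
  have hint : Integrable (fun θ ↦ θ - m) ν := integrable_of_continuous hν (by fun_prop)
  have hi (a b : ℝ) : IntervalIntegrable (fun θ ↦ θ - m) ν a b := hint.intervalIntegrable
  have y1 := hy.lt_right
  have z1 := hz.left_lt
  have e1 := hy.integral_sub_eq_zero
  have e2 := hz.integral_sub_eq_zero
  have e3 : ∫ θ in Icc y z, (θ - m) ∂ν ≤ 0 :=
    setIntegral_nonpos measurableSet_Icc fun θ hθ ↦ by linarith [hθ.2]
  have e4 : 0 ≤ ∫ θ in Icc (y + 2 * q) (z + 2 * q), (θ - m) ∂ν :=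
    setIntegral_nonneg measurableSet_Icc fun θ hθ ↦ by linarith [hθ.1]
  have e5 : ∫ θ in Icc y z, (θ - m) ∂ν = ∫ θ in Icc (y + 2 * q) (z + 2 * q), (θ - m) ∂ν := by
    rw [setIntegral_Icc_eq_intervalIntegral (by linarith)] at e1 e2 ⊢
    rw [setIntegral_Icc_eq_intervalIntegral (by linarith)]
    have a1 := intervalIntegral.integral_add_adjacent_intervals (hi y z) (hi z (z + 2 * q))
    have a2 := intervalIntegral.integral_add_adjacent_intervals (hi y (y + 2 * q))
      (hi (y + 2 * q) (z + 2 * q))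
    linarith
  have hzL : z ≤ L := by
    by_contra! hc
    have := setIntegral_sub_neg hν z1.le (hpos y z hyz (by linarith [hm.2]) hc)
    linarith
  have hyH : H ≤ y + 2 * q := by
    by_contra! hc
    have := setIntegral_sub_pos hν y1.le (hpos _ (z + 2 * q) (by linarith) hc (by linarith [hm.1]))
    linarith
  have : ∫ θ, θ ∂ν = m := by
    have hI : ∀ᵐ θ ∂ν, θ ∈ Icc y (y + 2 * q) :=
      hν.mono fun θ hθ ↦ ⟨by linarith [hθ.1], by linarith [hθ.2]⟩
    rw [Measure.restrict_eq_self_of_ae_mem hI, integral_sub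
      (integrable_of_continuous hν (by fun_prop)) (integrable_const _)] at e1
    simp only [integral_const, probReal_univ, one_smul] at e1
    linarith
  linarith [hmean this]

end Thresholds

/-! ### The law of the highest of `J` draws. -/

section HighestValue

variable {P : Measure ℝ} {J : ℕ}

theorem tendsto_powStieltjes_atBot (hJ : J ≠ 0) : Tendsto (powStieltjes P J) atBot (𝓝 0) := by
  simpa [hJ] using! (tendsto_cdf_atBot P).pow J

theorem tendsto_powStieltjes_atTop : Tendsto (powStieltjes P J) atTop (𝓝 1) := by
  simpa using! (tendsto_cdf_atTop P).pow J

theorem isProbabilityMeasure_highestValueLaw (hJ : J ≠ 0) :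
    IsProbabilityMeasure (highestValueLaw P J) :=
  StieltjesFunction.isProbabilityMeasure _ (tendsto_powStieltjes_atBot hJ)
    tendsto_powStieltjes_atTop

theorem cdf_highestValueLaw (hJ : J ≠ 0) : cdf (highestValueLaw P J) = powStieltjes P J :=
  cdf_measure_stieltjesFunction _ (tendsto_powStieltjes_atBot hJ) tendsto_powStieltjes_atTop

theorem nullSingletonClass_highestValueLaw [IsProbabilityMeasure P] [NullSingletonClass P] :
    NullSingletonClass (highestValueLaw P J) where
  measure_singleton x := by
    have hc : Continuous (powStieltjes P J) := continuous_cdf.pow J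
    have h := (powStieltjes P J).mono.continuousAt_iff_leftLim_eq_rightLim.1
      (hc.continuousAt (x := x))
    rw [StieltjesFunction.rightLim_eq] at h
    rw [highestValueLaw, StieltjesFunction.measure_singleton, h, sub_self, ENNReal.ofReal_zero]

section Support

variable [IsProbabilityMeasure P] {L H : ℝ}

theorem cdf_right_endpoint (hP : P.support = Icc L H) : cdf P H = 1 := by
  have : P.real (Ioi H) = 0 := by
    rw [measureReal_eq_zero_iff]
    refine measure_mono_null (fun x hx ↦ ?_) (Measure.measure_compl_support (μ := P))
    rw [hP]
    exact fun h ↦ (mem_Ioi.1 hx).not_ge h.2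
  rw [measureReal_Ioi_eq] at this
  linarith

variable [NullSingletonClass P]

theorem cdf_left_endpoint (hP : P.support = Icc L H) : cdf P L = 0 := by
  rw [cdf_eq_real, measureReal_congr Iio_ae_eq_Iic.symm, measureReal_eq_zero_iff]
  refine measure_mono_null (fun x hx ↦ ?_) (Measure.measure_compl_support (μ := P))
  rw [hP]
  exact fun h ↦ (mem_Iio.1 hx).not_ge h.1

theorem cdf_lt_cdf (hLH : L < H) (hP : P.support = Icc L H) {a b : ℝ} (hab : a < b) (ha : a < H)
    (hb : L < b) : cdf P a < cdf P b := by
  obtain ⟨x, h1, h2⟩ := exists_between (max_lt (lt_min hab ha) (lt_min hb hLH))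
  have hx : x ∈ P.support := by
    rw [hP]
    exact ⟨(le_max_right _ _).trans h1.le, h2.le.trans (min_le_right _ _)⟩
  have h := (Measure.mem_support_iff_forall x).1 hx _
    (Icc_mem_nhds ((le_max_left _ _).trans_lt h1) (h2.trans_le (min_le_left _ _)))
  have h := ENNReal.toReal_pos h.ne' (measure_ne_top _ _)
  rw [← measureReal_def, measureReal_Icc_eq hab.le] at h
  linarith

theorem priorMean_mem_Ioo (hP : P.support = Icc L H) : priorMean P ∈ Ioo L H := by
  have hν := ae_mem_Icc_of_cdf (cdf_left_endpoint hP) (cdf_right_endpoint hP)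
  have hi : Integrable (fun θ ↦ θ) P := integrable_of_continuous hν continuous_id
  have hne (c : ℝ) : ¬ ∀ᵐ θ ∂P, θ = c := fun h ↦ by
    have h' : ∀ᵐ θ ∂P, θ ≠ c := measure_eq_zero_iff_ae_notMem.1 (measure_singleton c)
    obtain ⟨θ, h1, h2⟩ := (h.and h').exists
    exact h2 h1
  have hc (c : ℝ) : ∫ _, c ∂P = c := by simp
  have h1 : ∫ _, L ∂P ≤ ∫ θ, θ ∂P :=
    integral_mono_ae (integrable_const _) hi (hν.mono fun θ hθ ↦ hθ.1)
  have h2 : ∫ θ, θ ∂P ≤ ∫ _, H ∂P :=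
    integral_mono_ae hi (integrable_const _) (hν.mono fun θ hθ ↦ hθ.2)
  constructor
  · rw [← hc L]
    refine h1.lt_of_ne fun e ↦ hne L ?_
    filter_upwards [(integral_eq_iff_of_ae_le (integrable_const _) hi
      (hν.mono fun θ hθ ↦ hθ.1)).1 e] with θ hθ using hθ.symm
  · rw [← hc H]
    exact h2.lt_of_ne fun e ↦ hne H ((integral_eq_iff_of_ae_le hi (integrable_const _)
      (hν.mono fun θ hθ ↦ hθ.2)).1 e)

theorem ae_mem_highestValueLaw (hJ : J ≠ 0) (hP : P.support = Icc L H) :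
    ∀ᵐ θ ∂highestValueLaw P J, θ ∈ Icc L H := by
  have := isProbabilityMeasure_highestValueLaw (P := P) hJ
  refine ae_mem_Icc_of_cdf ?_ ?_ <;> rw [cdf_highestValueLaw hJ]
  · exact (congrArg (· ^ J) (cdf_left_endpoint hP)).trans (zero_pow hJ)
  · exact (congrArg (· ^ J) (cdf_right_endpoint hP)).trans (one_pow J)

theorem measureReal_Icc_highestValueLaw (hJ : J ≠ 0) {a b : ℝ} (hab : a ≤ b) :
    (highestValueLaw P J).real (Icc a b) = cdf P b ^ J - cdf P a ^ J := by
  have := isProbabilityMeasure_highestValueLaw (P := P) hJ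
  have := nullSingletonClass_highestValueLaw (P := P) (J := J)
  rw [measureReal_Icc_eq hab, cdf_highestValueLaw hJ]
  rfl

theorem measureReal_Icc_highestValueLaw_pos (hJ : J ≠ 0) (hLH : L < H) (hP : P.support = Icc L H)
    {a b : ℝ} (hab : a < b) (ha : a < H) (hb : L < b) :
    0 < (highestValueLaw P J).real (Icc a b) := by
  rw [measureReal_Icc_highestValueLaw hJ hab.le, sub_pos]
  exact pow_lt_pow_left₀ (cdf_lt_cdf hLH hP hab ha hb) (cdf_nonneg _ _) hJ

/-- The best of several draws is better on average than a single one. -/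
theorem priorMean_lt_integral_highestValueLaw (hJ : 1 < J) (hLH : L < H)
    (hP : P.support = Icc L H) : priorMean P < ∫ θ, θ ∂highestValueLaw P J := by
  have hJ0 : J ≠ 0 := by omega
  have := isProbabilityMeasure_highestValueLaw (P := P) hJ0
  have hν := ae_mem_Icc_of_cdf (cdf_left_endpoint hP) (cdf_right_endpoint hP)
  have hG := ae_mem_highestValueLaw hJ0 hP
  have h1 := integral_cdf_eq hν hLH.le
  have h2 := integral_cdf_eq hG hLH.le
  rw [call_eq_mean_sub hν le_rfl] at h1
  rw [call_eq_mean_sub hG le_rfl, cdf_highestValueLaw hJ0] at h2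
  change ∫ t in L..H, cdf P t ^ J = _ at h2
  obtain ⟨c, hc1, hc2⟩ := exists_between hLH
  have hc0 : 0 < cdf P c := cdf_left_endpoint hP ▸ cdf_lt_cdf hLH hP hc1 hLH hc1
  have hc3 : cdf P c < 1 := cdf_right_endpoint hP ▸ cdf_lt_cdf hLH hP hc2 hc2 hLH
  -- A smaller integrated distribution function means a larger mean; strictness comes from an
  -- interior point, where `0 < F < 1`.
  have hlt : ∫ t in L..H, cdf P t ^ J < ∫ t in L..H, cdf P t :=
    intervalIntegral.integral_lt_integral_of_continuousOn_of_le_of_exists_lt hLH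
      (continuous_cdf.pow J).continuousOn continuous_cdf.continuousOn
      (fun t _ ↦ pow_le_of_le_one (cdf_nonneg _ _) (cdf_le_one _ _) hJ0)
      ⟨c, ⟨hc1.le, hc2.le⟩, pow_lt_self_of_lt_one₀ hc0 hc3 hJ⟩
  rw [priorMean]
  linarith

end Support

end HighestValue

/-! ### The design problem. -/

theorem objective_eq {L H m lam q : ℝ} {Q : Measure ℝ} (hQ : ∀ᵐ θ ∂Q, θ ∈ Icc L H) :
    objective L H m lam q Q =
      (1 - lam) * (offPrice m q - q ^ 2 / 2) + lam * ∫ θ, onProfit m q θ ∂Q := by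
  rw [objective, Measure.restrict_eq_self_of_ae_mem hQ]

theorem feasible_iff {P Q : Measure ℝ} [IsProbabilityMeasure P] [NullSingletonClass P]
    {L H : ℝ} {J : ℕ}
    (hJ : J ≠ 0) (hLH : L < H) (hP : P.support = Icc L H) :
    Feasible L H J P Q ↔ IsProbabilityMeasure Q ∧ (∀ᵐ θ ∂Q, θ ∈ Icc L H) ∧
      (∀ t, call Q t ≤ call (highestValueLaw P J) t) ∧
        ∫ θ, θ ∂Q = ∫ θ, θ ∂highestValueLaw P J := by
  have := isProbabilityMeasure_highestValueLaw (P := P) hJ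
  unfold Feasible
  rw [← cdf_highestValueLaw hJ]
  refine and_congr_right fun hQ ↦ and_congr_right fun hQ' ↦ ?_
  exact isMeanPreservingSpread_iff hLH.le hQ' (ae_mem_highestValueLaw hJ hP)

theorem isOptimalDesign_iff_eq_pool {P : Measure ℝ} [IsProbabilityMeasure P] [NullSingletonClass P]
    {L H : ℝ} {J : ℕ} (hJ : J ≠ 0) (hLH : L < H) (hP : P.support = Icc L H) {lam q x₁ x₂ : ℝ}
    (hlam : 0 < lam)
    (h : IsPoolingInterval (highestValueLaw P J) L H (priorMean P) q x₁ x₂) (R : Measure ℝ) :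
    IsOptimalDesign L H J P lam q R ↔
      R = pool (highestValueLaw P J) (Icc x₁ x₂) (priorMean P) := by
  have := isProbabilityMeasure_highestValueLaw (P := P) hJ
  have hpool : Feasible L H J P (pool (highestValueLaw P J) (Icc x₁ x₂) (priorMean P)) :=
    (feasible_iff hJ hLH hP).2 ⟨isProbabilityMeasure_pool measurableSet_Icc, h.ae_mem_pool,
      h.call_pool_le, h.integral_pool_id⟩
  have hle {S : Measure ℝ} (hS : Feasible L H J P S) : ∫ θ, onProfit (priorMean P) q θ ∂S ≤
      ∫ θ, onProfit (priorMean P) q θ ∂pool (highestValueLaw P J) (Icc x₁ x₂) (priorMean P) := by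
    obtain ⟨h1, h2, h3, h4⟩ := (feasible_iff hJ hLH hP).1 hS
    rw [h.integral_onProfit_pool]
    exact (h.integral_onProfit_le h2).trans (h.integral_shadowPrice_le h2 h3 h4).1
  constructor
  · rintro ⟨hR, hopt⟩
    obtain ⟨h1, h2, h3, h4⟩ := (feasible_iff hJ hLH hP).1 hR
    refine h.eq_pool_of_integral_eq h2 h3 h4 ?_
    rw [← h.integral_onProfit_pool]
    -- Positive platform size lets equality of objectives pass to equality of expected profits.
    refine (hle hR).antisymm (le_of_mul_le_mul_left ?_ hlam)
    have := hopt _ hpool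
    rw [objective_eq h2, objective_eq hpool.2.1] at this
    linarith
  · rintro rfl
    refine ⟨hpool, fun S hS ↦ ?_⟩
    rw [objective_eq hS.2.1, objective_eq hpool.2.1]
    have := mul_le_mul_of_nonneg_left (hle hS) hlam.le
    linarith

theorem pool_real_singleton {ν : Measure ℝ} [NullSingletonClass ν] {I : Set ℝ} {m : ℝ} :
    (pool ν I m).real {m} = ν.real I := by
  have : ν.restrict Iᶜ {m} = 0 := measure_singleton m
  simp [pool, measureReal_def, this]

end ManagedCampaign

open ManagedCampaign in
theorem proposition8 (θL θH : ℝ) (hθL : 0 ≤ θL) (hθ : θL < θH)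
    (P : Measure ℝ) [IsProbabilityMeasure P]
    (hP₀ : ∀ x : ℝ, P {x} = 0) (hP : P.support = Set.Icc θL θH)
    (J : ℕ) (hJ : 1 ≤ J) (lam : ℝ) (hlam₀ : 0 < lam) (hlam₁ : lam ≤ 1)
    (qhat : ℝ) (hq : 0 < qhat) (hJq : J = 1 → 2 * qhat ≤ θH - θL) :
    ∃ x₁ x₂ : ℝ, x₁ ≤ ManagedCampaign.priorMean P ∧ ManagedCampaign.priorMean P ≤ x₂ ∧
      -- the thresholds are the unique solution of the two equations
      (∀ y₁ y₂ : ℝ, ManagedCampaign.ThresholdEquations J P qhat y₁ y₂ ↔ y₁ = x₁ ∧ y₂ = x₂) ∧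
      -- there is exactly one optimal distribution, of the stated form
      ∃ Q : Measure ℝ,
        (∀ R : Measure ℝ, ManagedCampaign.IsOptimalDesign θL θH J P lam qhat R ↔ R = Q) ∧
        Set.EqOn (cdf Q) (fun θ => cdf P θ ^ J) (Set.Iic x₁) ∧
        Set.EqOn (cdf Q) (fun θ => cdf P θ ^ J) (Set.Ici x₂) ∧
        0 < Q.real {ManagedCampaign.priorMean P} ∧
        Q.real {ManagedCampaign.priorMean P} = cdf P x₂ ^ J - cdf P x₁ ^ J := by
  have : NullSingletonClass P := ⟨hP₀⟩
  have hJ0 : J ≠ 0 := by omega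
  have := isProbabilityMeasure_highestValueLaw (P := P) hJ0
  have := nullSingletonClass_highestValueLaw (P := P) (J := J)
  have hm := priorMean_mem_Ioo hP
  have hG := ae_mem_highestValueLaw hJ0 hP
  have hpos (a b : ℝ) (hab : a < b) (ha : a < θH) (hb : θL < b) :=
    measureReal_Icc_highestValueLaw_pos hJ0 hθ hP hab ha hb
  -- For `J > 1` the mean of `F ^ J` exceeds `μ`, so only `J = 1` needs the bound on `qhat`.
  have hmean (h : ∫ θ, θ ∂highestValueLaw P J = priorMean P) : 2 * qhat ≤ θH - θL := by
    refine hJq (hJ.eq_or_lt.elim Eq.symm fun hJ1 ↦ ?_)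
    exact absurd h (priorMean_lt_integral_highestValueLaw hJ1 hθ hP).ne'
  obtain ⟨x, hx⟩ := exists_isPoolingInterval hG hm hq hpos
  have hxpos : 0 < (highestValueLaw P J).real (Icc x (x + 2 * qhat)) :=
    hpos _ _ (by linarith) (by linarith [hx.left_lt, hm.2]) (by linarith [hx.lt_right, hm.1])
  have hcond (I : Set ℝ) := integral_cond_eq_iff hG (by linarith [hm.1] : priorMean P ≠ 0) I
  have hcdf {v : ℝ} (hv : v ≤ x ∨ x + 2 * qhat ≤ v) :
      cdf (pool (highestValueLaw P J) (Icc x (x + 2 * qhat)) (priorMean P)) v = cdf P v ^ J := by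
    rw [hx.cdf_pool hv, cdf_highestValueLaw hJ0]
    rfl
  refine ⟨x, x + 2 * qhat, hx.left_lt.le, hx.lt_right.le, fun y₁ y₂ ↦ ⟨?_, ?_⟩,
    pool (highestValueLaw P J) (Icc x (x + 2 * qhat)) (priorMean P),
    isOptimalDesign_iff_eq_pool hJ0 hθ hP hlam₀ hx, fun v hv ↦ hcdf (.inl hv),
    fun v hv ↦ hcdf (.inr hv), ?_, ?_⟩
  · rintro ⟨rfl, hy⟩
    obtain ⟨h1, h2⟩ := (hcond _).1 hy
    have hy' := isPoolingInterval_of_measureReal_pos hG ⟨hm.1.le, hm.2.le⟩ h1 h2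
    have : y₁ = x := le_antisymm (not_lt.1 (not_lt_of_isPoolingInterval hm hpos hmean hx hy'))
      (not_lt.1 (not_lt_of_isPoolingInterval hm hpos hmean hy' hx))
    exact ⟨this, by rw [this]⟩
  · rintro ⟨rfl, rfl⟩
    exact ⟨rfl, (hcond _).2 ⟨hxpos, hx.integral_sub_eq_zero⟩⟩
  · rwa [pool_real_singleton]
  · rw [pool_real_singleton, measureReal_Icc_highestValueLaw hJ0 (by linarith)]
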